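/- Let $k$ be a field and let $Q$ be a quiver with finitely many vertices. Paths are composed from right to left, so that for a path $p$ from $a$ to $b$ we have $p = e_b\,p\,e_a$ in the path algebra $kQ$; a vertex is identified with its stationary path. Let $n\ge 1$ and let $V_1,\dots,V_n$ be a partition of the vertex set of $Q$ such that 1. there are no arrows from a vertex in $V_i$ to a vertex in $V_j$ if $i<j$; 2. there are no arrows between distinct vertices in each $V_i$. Let $A = kQ/I$, where $I$ is an admissible two-sided ideal (that is, $J^m\subseteq I\subseteq J^2$ for some $m\ge 2$, with $J$ the ideal generated by the arrows). Let $B$ be the unital subalgebra of $A$ generated by the vertices and arrows of a quiver $R$, where the vertices and arrows of $R$ are elements of $A$ such that * (i) each vertex of $R$ is a sum of (distinct) vertices of $Q$; * (ii) each arrow $\beta$ of $R$ is (the class in $A$ of) a linear combination of paths in $Q$ such that for every vertex $e$ of $Q$ there are vertices $h,g$ of $Q$ with $\beta e = h\beta e$ and $e\beta = e\beta g$ in $A$. Suppose furthermore that for each vertex $e$ of $Q$ and each loop (arrow) $\gamma$ of $Q$ at $e$ there is an element $\beta\in B$ such that $\gamma = e\beta$ in $A$. Then $$\operatorname{gldim}(A,B)\le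 n-1 .$$ Here a left $A$-module $M$ is $(A,B)$-projective if every $A$-module homomorphism onto $M$ that splits as a homomorphism of $B$-modules splits as a homomorphism of $A$-modules. The relative projective dimension $\operatorname{pd}_{(A,B)}M\in\{0,1,2,\dots,\infty\}$ is the least $m$ for which there is an exact sequence of $A$-modules $0\to P_m\to\cdots\to P_0\to M\to 0$ with all $P_i$ $(A,B)$-projective in which the kernel of every map is a direct summand as a $B$-module ($\infty$ if there is none), and $\operatorname{gldim}(A,B)$ is the supremum of $\operatorname{pd}_{(A,B)}M$ over all left $A$-modules $M$. -/

import Mathlib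

/-! ### The path algebra of a quiver -/

section PathAlgebra

universe u v w

/-- The path algebra `kQ`: the vector space with basis all paths of the quiver `Q`
(one stationary path for every vertex included). -/
def PathAlgebra (k : Type u) (Q : Type v) [Field k] [Quiver.{w} Q] : Type (max u v w) :=
  (Σ a b : Q, Quiver.Path a b) →₀ k

namespace PathAlgebra

variable (k : Type u) {Q : Type v} [Field k] [Quiver.{w} Q]

noncomputable instance : AddCommGroup (PathAlgebra k Q) :=
  inferInstanceAs (AddCommGroup ((Σ a b : Q, Quiver.Path a b) →₀ k))

noncomputable instance : Module k (PathAlgebra k Q) :=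
  inferInstanceAs (Module k ((Σ a b : Q, Quiver.Path a b) →₀ k))

/-- The basis element of `kQ` given by a path. -/
noncomputable def ofPath {a b : Q} (p : Quiver.Path a b) : PathAlgebra k Q :=
  Finsupp.single (⟨a, b, p⟩ : Σ a b : Q, Quiver.Path a b) (1 : k)

/-- The stationary path at a vertex `e`, as an element of `kQ`. -/
noncomputable def vertex (e : Q) : PathAlgebra k Q := ofPath k (Quiver.Path.nil : Quiver.Path e e)

/-- An arrow, as an element of `kQ`. -/
noncomputable def arrow {a b : Q} (γ : a ⟶ b) : PathAlgebra k Q := ofPath k γ.toPath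

open Classical in
/-- The product `p * q` of two paths: first `q`, then `p` (paths are composed from right to left),
and `0` if `q` does not end where `p` starts. -/
noncomputable def pathMul (p q : Σ a b : Q, Quiver.Path a b) : PathAlgebra k Q :=
  if h : q.2.1 = p.1 then ofPath k ((q.2.2.cast rfl h).comp p.2.2) else 0

/-- The multiplication of `kQ`: the bilinear extension of the product of paths. -/
noncomputable def mulLin : PathAlgebra k Q →ₗ[k] PathAlgebra k Q →ₗ[k] PathAlgebra k Q :=
  Finsupp.lift _ k _ fun p => Finsupp.lift _ k _ fun q => pathMul k p q

noncomputable instance : Mul (PathAlgebra k Q) := ⟨fun x y => mulLin k x y⟩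

theorem mul_def (x y : PathAlgebra k Q) : x * y = mulLin k x y := rfl

theorem mulLin_ofPath {a b c d : Q} (p : Quiver.Path c d) (q : Quiver.Path a b) :
    mulLin k (ofPath k p) (ofPath k q) = pathMul k ⟨c, d, p⟩ ⟨a, b, q⟩ := by
  have h1 : mulLin k (ofPath k p) = Finsupp.lift (PathAlgebra k Q) k _
      fun q => pathMul k ⟨c, d, p⟩ q :=
    (Finsupp.sum_single_index (by simp)).trans (one_smul k _)
  rw [h1]
  exact (Finsupp.sum_single_index (by simp)).trans (one_smul k _)

theorem ofPath_mul_ofPath {a b c : Q} (p : Quiver.Path b c) (q : Quiver.Path a b) :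
    ofPath k p * ofPath k q = ofPath k (q.comp p) := by
  rw [mul_def, mulLin_ofPath]
  simp [pathMul]

theorem ofPath_mul_ofPath_of_ne {a b b' c : Q} (p : Quiver.Path b c) (q : Quiver.Path a b')
    (h : b' ≠ b) : ofPath k p * ofPath k q = 0 := by
  rw [mul_def, mulLin_ofPath]
  simp [pathMul, h]

variable {k} in
/-- To prove a statement closed under sums and scalars for all of `kQ`, prove it for paths. -/
theorem induction {P : PathAlgebra k Q → Prop} (x : PathAlgebra k Q) (h0 : P 0)
    (hp : ∀ (a b : Q) (p : Quiver.Path a b), P (ofPath k p))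
    (ha : ∀ x y, P x → P y → P (x + y)) (hs : ∀ (c : k) (x), P x → P (c • x)) : P x := by
  refine Finsupp.induction_linear x h0 (fun f g => ha f g) ?_
  rintro ⟨a, b, p⟩ c
  have h : (Finsupp.single (⟨a, b, p⟩ : Σ a b : Q, Quiver.Path a b) c : PathAlgebra k Q)
      = c • ofPath k p := (Finsupp.smul_single_one _ c).symm
  exact Eq.mpr (congrArg P h) (hs c _ (hp a b p))

theorem ofPath_mul_assoc {a b c d e f : Q} (p : Quiver.Path a b) (q : Quiver.Path c d)
    (r : Quiver.Path e f) :
    ofPath k p * ofPath k q * ofPath k r = ofPath k p * (ofPath k q * ofPath k r) := by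
  have z1 (x : PathAlgebra k Q) : 0 * x = 0 := by simp [mul_def]
  have z2 (x : PathAlgebra k Q) : x * 0 = 0 := by simp [mul_def]
  by_cases h1 : d = a
  · subst h1
    by_cases h2 : f = c
    · subst h2
      simp [ofPath_mul_ofPath]
    · simp [ofPath_mul_ofPath, ofPath_mul_ofPath_of_ne k _ _ h2, z2]
  · by_cases h2 : f = c
    · subst h2
      simp [ofPath_mul_ofPath, ofPath_mul_ofPath_of_ne k _ _ h1, z1]
    · simp [ofPath_mul_ofPath_of_ne k _ _ h1, ofPath_mul_ofPath_of_ne k _ _ h2, z1, z2]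

variable [Fintype Q]

/-- The unit of `kQ`, for a quiver with finitely many vertices: the sum of all vertices. -/
noncomputable instance : One (PathAlgebra k Q) := ⟨∑ e : Q, vertex k e⟩

theorem one_def : (1 : PathAlgebra k Q) = ∑ e : Q, vertex k e := rfl

noncomputable instance : Ring (PathAlgebra k Q) :=
  { (inferInstance : AddCommGroup (PathAlgebra k Q)) with
    mul := (· * ·)
    one := 1
    left_distrib := fun x y z => by simp [mul_def]
    right_distrib := fun x y z => by simp [mul_def]
    zero_mul := fun x => by simp [mul_def]
    mul_zero := fun x => by simp [mul_def]
    mul_assoc := fun x y z => by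
      refine induction (P := fun x => x * y * z = x * (y * z)) x ?_ (fun a b p => ?_) ?_ ?_
      · simp [mul_def]
      · refine induction (P := fun y => ofPath k p * y * z = ofPath k p * (y * z)) y ?_
          (fun c d q => ?_) ?_ ?_
        · simp [mul_def]
        · refine induction (P := fun z => ofPath k p * ofPath k q * z
            = ofPath k p * (ofPath k q * z)) z ?_ (fun e f r => ?_) ?_ ?_
          · simp [mul_def]
          · exact ofPath_mul_assoc k p q r
          · intro s t hs ht
            simp only [mul_def, map_add] at hs ht ⊢
            rw [hs, ht]
          · intro s t ht
            simp only [mul_def, map_smul] at ht ⊢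
            rw [ht]
        · intro s t hs ht
          simp only [mul_def, map_add, LinearMap.add_apply] at hs ht ⊢
          rw [hs, ht]
        · intro s t ht
          simp only [mul_def, map_smul, LinearMap.smul_apply] at ht ⊢
          rw [ht]
      · intro s t hs ht
        simp only [mul_def, map_add, LinearMap.add_apply] at hs ht ⊢
        rw [hs, ht]
      · intro s t ht
        simp only [mul_def, map_smul, LinearMap.smul_apply] at ht ⊢
        rw [ht]
    one_mul := fun x => by
      refine induction (P := fun x => 1 * x = x) x (by simp [mul_def]) (fun a b p => ?_) ?_ ?_
      · have h (e : Q) (he : e ≠ b) : vertex k e * ofPath k p = 0 :=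
          ofPath_mul_ofPath_of_ne k _ _ he.symm
        rw [one_def, mul_def, map_sum, LinearMap.sum_apply]
        simp only [← mul_def]
        rw [Finset.sum_eq_single b (fun e _ he => h e he) (by simp), vertex, ofPath_mul_ofPath,
          Quiver.Path.comp_nil]
      · intro s t hs ht
        simp only [mul_def, map_add] at hs ht ⊢
        rw [hs, ht]
      · intro s t ht
        simp only [mul_def, map_smul] at ht ⊢
        rw [ht]
    mul_one := fun x => by
      refine induction (P := fun x => x * 1 = x) x (by simp [mul_def]) (fun a b p => ?_) ?_ ?_
      · have h (e : Q) (he : e ≠ a) : ofPath k p * vertex k e = 0 :=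
          ofPath_mul_ofPath_of_ne k _ _ he
        rw [one_def, mul_def, map_sum]
        simp only [← mul_def]
        rw [Finset.sum_eq_single a (fun e _ he => h e he) (by simp), vertex, ofPath_mul_ofPath,
          Quiver.Path.nil_comp]
      · intro s t hs ht
        simp only [mul_def, map_add, LinearMap.add_apply] at hs ht ⊢
        rw [hs, ht]
      · intro s t ht
        simp only [mul_def, map_smul, LinearMap.smul_apply] at ht ⊢
        rw [ht] }

noncomputable instance : Algebra k (PathAlgebra k Q) :=
  Algebra.ofModule
    (fun r x y => by
      change mulLin k (r • x) y = r • mulLin k x y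
      simp)
    (fun r x y => by
      change mulLin k x (r • y) = r • mulLin k x y
      simp)

variable (Q) in
/-- The ideal `J` of `kQ` generated by the arrows, i.e. the span of all paths of positive length. -/
noncomputable def arrowIdeal : Submodule k (PathAlgebra k Q) :=
  Submodule.span k {x | ∃ (a b : Q) (p : Quiver.Path a b), 0 < p.length ∧ x = ofPath k p}

/-- A two-sided ideal `I` of `kQ` is admissible if `J ^ m ⊆ I ⊆ J ^ 2` for some `m ≥ 2`, where
`J` is the ideal generated by the arrows. -/
def IsAdmissible {k : Type u} {Q : Type v} [Field k] [Quiver.{w} Q] [Fintype Q]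
    (I : Ideal (PathAlgebra k Q)) : Prop :=
  ∃ m : ℕ, 2 ≤ m ∧ arrowIdeal k Q ^ m ≤ I.restrictScalars k ∧
    I.restrictScalars k ≤ arrowIdeal k Q ^ 2

/-- The image in `A = kQ/I` of a vertex of `Q`. -/
noncomputable def vertexBar {k : Type u} {Q : Type v} [Field k] [Quiver.{w} Q] [Fintype Q]
    (I : Ideal (PathAlgebra k Q)) [I.IsTwoSided] (e : Q) : PathAlgebra k Q ⧸ I :=
  Ideal.Quotient.mk I (vertex k e)

/-- The image in `A = kQ/I` of an arrow of `Q`. -/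
noncomputable def arrowBar {k : Type u} {Q : Type v} [Field k] [Quiver.{w} Q] [Fintype Q]
    (I : Ideal (PathAlgebra k Q)) [I.IsTwoSided] {a b : Q} (γ : a ⟶ b) : PathAlgebra k Q ⧸ I :=
  Ideal.Quotient.mk I (arrow k γ)

end PathAlgebra

end PathAlgebra

/-! ### Relative homological algebra of an extension of algebras -/

section Relative

universe u v w

variable {k : Type u} {A : Type v} [Field k] [Ring A] [Algebra k A]

/-- An `A`-module `M` is `(A, B)`-projective if every surjective `A`-linear map onto `M` that
splits as a map of `B`-modules splits as a map of `A`-modules. -/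
def IsRelProjective (B : Subalgebra k A) (M : Type w) [AddCommGroup M] [Module A M] : Prop :=
  ∀ (N : Type w) [AddCommGroup N] [Module A N] (f : N →ₗ[A] M), Function.Surjective f →
    (∃ s : M →ₗ[B] N, ∀ x, f (s x) = x) → ∃ t : M →ₗ[A] N, ∀ x, f (t x) = x

/-- The kernel of the `A`-linear map `f` is a direct summand of its domain as a `B`-module. -/
def KerIsSummand (B : Subalgebra k A) {M N : Type w} [AddCommGroup M] [Module A M]
    [AddCommGroup N] [Module A N] (f : M →ₗ[A] N) : Prop :=
  ∃ C : Submodule B M, IsCompl ((LinearMap.ker f).restrictScalars B) C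

/-- An `(A, B)`-exact sequence `0 → P n → ⋯ → P 1 → P 0 → M → 0` of `A`-modules in which all `P i`
are `(A, B)`-projective. The sequence is continued to the left by zero modules `P i`, `i > n`. -/
structure RelProjResolution (B : Subalgebra k A) (M : Type w) [AddCommGroup M] [Module A M]
    (n : ℕ) where
  P : ℕ → ModuleCat.{w} A
  d : ∀ i, P (i + 1) →ₗ[A] P i
  ε : P 0 →ₗ[A] M
  relProjective : ∀ i, IsRelProjective B (P i)
  subsingleton : ∀ i, n < i → Subsingleton (P i)
  surjective : Function.Surjective ε
  exact_zero : Function.Exact (d 0) ε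
  exact_succ : ∀ i, Function.Exact (d (i + 1)) (d i)
  summand_zero : KerIsSummand B ε
  summand_succ : ∀ i, KerIsSummand B (d i)

/-- The relative projective dimension `pd_(A,B) M`: the least length of an `(A, B)`-exact
resolution of `M` by `(A, B)`-projective modules, and `⊤` if there is none. -/
noncomputable def relProjDim (B : Subalgebra k A) (M : Type w) [AddCommGroup M] [Module A M] :
    ℕ∞ :=
  ⨅ (n : ℕ) (_ : Nonempty (RelProjResolution B M n)), (n : ℕ∞)

/-- The left relative global dimension `gldim(A, B)`: the supremum of the relative projective
dimensions of all left `A`-modules (in the universe `w`). -/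
noncomputable def relGlobalDim (B : Subalgebra k A) : ℕ∞ :=
  ⨆ M : ModuleCat.{w} A, relProjDim B M

end Relative

universe u v w v' w' z

/-! ### Induction along a subring given by generators. -/

section InducedModule

variable {A : Type v} [Ring A]

/-! Let `C` be the subring of `A` generated by `B` and all vertices of `Q`. It contains every loop,
since a loop is `e * β` with `β ∈ B`.

Averaging, `s ↦ ∑ e, e • s (e • -)`, turns a `B`-linear section of an `A`-linear map into a
`C`-linear one, because each generator of `B` sends a vertex into at most one vertex on either side.
Hence the modules `A ⊗_C M` are `(A, B)`-projective, and `A ⊗_C M → M` splits over `B` by `m ↦ 1 ⊗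
m`. Iterating on kernels gives a relative resolution.

It stops because arrows never raise the index of the part. If `M` is supported at levels at most `i`
and `x` has level `i`, a path ending at `x` either starts at a higher level, where `M` vanishes, or
is a product of loops and so lies in `C`. Thus `A ⊗_C M → M` is injective at `x`, and its kernel
lives at levels below `i` (`supportedBelow_ker_counit`). The `n`-th kernel is zero.

`C` is never formed: linearity over the generating set `T` suffices, as the scalars commuting with
an additive map form a subring. -/

/-- The subring of all `a` which commute with the additive map `φ`. -/
noncomputable def linearitySubring (A : Type*) [Ring A] {M N : Type*} [AddCommGroup M] [Module A M]
    [AddCommGroup N] [Module A N] (φ : M →+ N) : Subring A where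
  carrier := {a | ∀ m, φ (a • m) = a • φ m}
  mul_mem' {a b} ha hb m := by rw [mul_smul, ha, hb, mul_smul]
  one_mem' m := by simp
  add_mem' {a b} ha hb m := by rw [add_smul, map_add, ha, hb, add_smul]
  zero_mem' m := by simp
  neg_mem' {a} ha m := by rw [neg_smul, map_neg, ha, neg_smul]

theorem mem_linearitySubring {M N : Type*} [AddCommGroup M] [Module A M] [AddCommGroup N]
    [Module A N] {φ : M →+ N} {a : A} :
    a ∈ linearitySubring A φ ↔ ∀ m, φ (a • m) = a • φ m := Iff.rfl

/-- The relations which make `m ↦ single m 1` additive and linear with respect to `T`. -/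
noncomputable def inducedRelations (T : Set A) (M : Type w) [AddCommGroup M] [Module A M] :
    Submodule A (M →₀ A) :=
  Submodule.span A
    ({x | ∃ m m' : M, x = Finsupp.single (m + m') 1 - Finsupp.single m 1 - Finsupp.single m' 1} ∪
      {x | ∃ t ∈ T, ∃ m : M, x = Finsupp.single (t • m) 1 - t • Finsupp.single m 1})

/-- The `A`-module induced from the restriction of `M` to the subring generated by `T`, that is
`A ⊗ M` over this subring. -/
abbrev InducedModule (T : Set A) (M : Type w) [AddCommGroup M] [Module A M] : Type (max v w) :=
  (M →₀ A) ⧸ inducedRelations T M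

namespace InducedModule

variable (T : Set A) (M : Type w) [AddCommGroup M] [Module A M]

/-- The canonical additive map `m ↦ 1 ⊗ m`. -/
noncomputable def unit : M →+ InducedModule T M :=
  AddMonoidHom.mk' (fun m => (inducedRelations T M).mkQ (Finsupp.single m 1)) fun m m' => by
    rw [← sub_eq_zero, ← sub_sub, ← map_sub, ← map_sub, ← LinearMap.mem_ker, Submodule.ker_mkQ]
    exact Submodule.subset_span (Or.inl ⟨m, m', rfl⟩)

theorem subset_linearitySubring_unit : T ⊆ (linearitySubring A (unit T M) : Set A) :=
    fun t ht m => by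
  change (inducedRelations T M).mkQ _ = t • (inducedRelations T M).mkQ _
  rw [← sub_eq_zero, ← map_smul, ← map_sub, ← LinearMap.mem_ker, Submodule.ker_mkQ]
  exact Submodule.subset_span (Or.inr ⟨t, ht, m, rfl⟩)

variable {T M}

theorem induction {P : InducedModule T M → Prop} (x : InducedModule T M) (h0 : P 0)
    (hadd : ∀ x y, P x → P y → P (x + y)) (hsmul : ∀ (a : A) (m : M), P (a • unit T M m)) :
    P x := by
  obtain ⟨y, rfl⟩ := (inducedRelations T M).mkQ_surjective x
  refine Finsupp.induction_linear y (by simpa using h0) (fun f g hf hg => ?_) fun m a => ?_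
  · rw [map_add]
    exact hadd _ _ hf hg
  · have : (Finsupp.single m a : M →₀ A) = a • Finsupp.single m 1 := by simp
    rw [this, map_smul]
    exact hsmul a m

theorem hom_ext {N : Type*} [AddCommGroup N] [Module A N] {f g : InducedModule T M →ₗ[A] N}
    (h : ∀ m, f (unit T M m) = g (unit T M m)) : f = g := by
  refine LinearMap.ext fun x => ?_
  refine induction (P := fun x => f x = g x) x (by simp) (fun x y hx hy => ?_) fun a m => ?_
  · rw [map_add, map_add, hx, hy]
  · rw [map_smul, map_smul, h]

theorem subsingleton [Subsingleton M] : Subsingleton (InducedModule T M) :=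
  subsingleton_of_forall_eq 0 fun x => induction (P := (· = 0)) x rfl
    (fun x y hx hy => by rw [hx, hy, add_zero]) fun a m => by
      rw [Subsingleton.elim m 0, map_zero, smul_zero]

/-- The universal property of the induced module. -/
noncomputable def lift {N : Type*} [AddCommGroup N] [Module A N] (φ : M →+ N)
    (hφ : T ⊆ (linearitySubring A φ : Set A)) : InducedModule T M →ₗ[A] N :=
  (inducedRelations T M).liftQ (Finsupp.linearCombination A φ) <| by
    refine Submodule.span_le.2 ?_
    rintro _ (⟨m, m', rfl⟩ | ⟨t, ht, m, rfl⟩)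
    · simp
    · simp [mem_linearitySubring.1 (hφ ht) m]

theorem lift_unit {N : Type*} [AddCommGroup N] [Module A N] (φ : M →+ N)
    (hφ : T ⊆ (linearitySubring A φ : Set A)) (m : M) : lift φ hφ (unit T M m) = φ m :=
  ((inducedRelations T M).liftQ_apply _ _).trans (by simp)

variable (T M) in
/-- The canonical `A`-linear map `a ⊗ m ↦ a • m`. -/
noncomputable def counit : InducedModule T M →ₗ[A] M :=
  lift (AddMonoidHom.id M) fun _ _ _ => rfl

theorem counit_unit (m : M) : counit T M (unit T M m) = m := lift_unit _ _ m

theorem counit_surjective : Function.Surjective (counit T M) := fun m => ⟨_, counit_unit m⟩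

end InducedModule

end InducedModule

/-! ### The relative resolution by induced modules. -/

section RelativeResolution

variable {k : Type u} {A : Type v} [Field k] [Ring A] [Algebra k A]

open InducedModule

/-- The map `m ↦ 1 ⊗ m` is a section of the counit commuting with `T`, so its range is a `B`-stable
complement. -/
theorem InducedModule.kerIsSummand_counit {B : Subalgebra k A} {T : Set A} (hBT : (B : Set A) ⊆ T)
    {M : Type (max v w)} [AddCommGroup M] [Module A M] : KerIsSummand B (counit T M) := by
  refine ⟨{ (unit T M).range with
    smul_mem' := ?_ }, ?_⟩
  · rintro b _ ⟨m, rfl⟩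
    exact ⟨(b : A) • m, subset_linearitySubring_unit T M (hBT b.2) m⟩
  · rw [isCompl_iff, Submodule.disjoint_def, codisjoint_iff, Submodule.eq_top_iff']
    constructor
    · rintro _ hx ⟨m, rfl⟩
      have hm : counit T M (unit T M m) = 0 := hx
      rw [counit_unit] at hm
      rw [hm, map_zero]
    · intro x
      refine Submodule.mem_sup.2 ⟨x - unit T M (counit T M x), ?_, unit T M (counit T M x),
        ⟨_, rfl⟩, sub_add_cancel _ _⟩
      change counit T M _ = 0
      rw [map_sub, counit_unit, sub_self]

/-- If `B`-linear sections can be replaced by sections linear with respect to `T`, then modules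
induced from `T` are `(A, B)`-projective. -/
theorem InducedModule.isRelProjective {B : Subalgebra k A} {T : Set A}
    (hT : ∀ (M N : Type (max v w)) [AddCommGroup M] [Module A M] [AddCommGroup N] [Module A N]
      (f : N →ₗ[A] M) (s : M →ₗ[B] N), (∀ x, f (s x) = x) →
      ∃ s' : M →+ N, T ⊆ (linearitySubring A s' : Set A) ∧ ∀ x, f (s' x) = x)
    {M : Type (max v w)} [AddCommGroup M] [Module A M] :
    IsRelProjective B (InducedModule T M) := by
  rintro N _ _ f - ⟨s, hs⟩
  obtain ⟨s', hs', hfs'⟩ := hT _ _ f s hs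
  -- A `T`-linear section restricted to `1 ⊗ M` extends to an `A`-linear map by the universal
  -- property; it is again a section, as can be checked on `1 ⊗ M`.
  have hφ : T ⊆ (linearitySubring A (s'.comp (unit T M)) : Set A) := fun t ht m => by
    rw [AddMonoidHom.comp_apply, subset_linearitySubring_unit T M ht, hs' ht]
    rfl
  refine ⟨lift _ hφ, fun x => ?_⟩
  have : f ∘ₗ lift _ hφ = LinearMap.id := hom_ext fun m => by
    rw [LinearMap.comp_apply, lift_unit]
    exact hfs' _
  exact LinearMap.congr_fun this x

/-- The iterated kernels of the canonical maps from induced modules. -/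
noncomputable def inducedSyzygy (T : Set A) (M : ModuleCat.{max v w} A) :
    ℕ → ModuleCat.{max v w} A
  | 0 => M
  | i + 1 => ModuleCat.of A (LinearMap.ker (counit T (inducedSyzygy T M i)))

/-- The differentials of the resolution by induced modules. -/
noncomputable def inducedDifferential (T : Set A) (M : ModuleCat.{max v w} A) (i : ℕ) :
    InducedModule T (inducedSyzygy T M (i + 1)) →ₗ[A] InducedModule T (inducedSyzygy T M i) :=
  (LinearMap.ker (counit T (inducedSyzygy T M i))).subtype ∘ₗ counit T (inducedSyzygy T M (i + 1))

theorem range_inducedDifferential (T : Set A) (M : ModuleCat.{max v w} A) (i : ℕ) :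
    LinearMap.range (inducedDifferential T M i) =
      LinearMap.ker (counit T (inducedSyzygy T M i)) :=
  (LinearMap.range_comp_of_range_eq_top _ (LinearMap.range_eq_top.2 counit_surjective)).trans
    (Submodule.range_subtype _)

theorem ker_inducedDifferential (T : Set A) (M : ModuleCat.{max v w} A) (i : ℕ) :
    LinearMap.ker (inducedDifferential T M i) =
      LinearMap.ker (counit T (inducedSyzygy T M (i + 1))) :=
  LinearMap.ker_comp_of_ker_eq_bot _ (Submodule.ker_subtype _)

/-- The resolution by induced modules, provided that the iterated kernels vanish eventually. -/
noncomputable def inducedResolution {B : Subalgebra k A} {T : Set A} (hBT : (B : Set A) ⊆ T)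
    (hT : ∀ (M N : Type (max v w)) [AddCommGroup M] [Module A M] [AddCommGroup N] [Module A N]
      (f : N →ₗ[A] M) (s : M →ₗ[B] N), (∀ x, f (s x) = x) →
      ∃ s' : M →+ N, T ⊆ (linearitySubring A s' : Set A) ∧ ∀ x, f (s' x) = x)
    (M : ModuleCat.{max v w} A) (n : ℕ)
    (hn : ∀ i, n < i → Subsingleton (inducedSyzygy T M i)) : RelProjResolution B M n where
  P i := ModuleCat.of A (InducedModule T (inducedSyzygy T M i))
  d i := inducedDifferential T M i
  ε := counit T M
  relProjective i := InducedModule.isRelProjective.{u, v, w} hT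
  subsingleton i hi := have := hn i hi; InducedModule.subsingleton
  surjective := counit_surjective
  exact_zero := LinearMap.exact_iff.2 (range_inducedDifferential T M 0).symm
  exact_succ i := LinearMap.exact_iff.2 <|
    (ker_inducedDifferential T M i).trans (range_inducedDifferential T M (i + 1)).symm
  summand_zero := kerIsSummand_counit.{u, v, w} hBT
  summand_succ i := by
    rw [KerIsSummand]
    erw [ker_inducedDifferential]
    exact kerIsSummand_counit.{u, v, w} hBT

end RelativeResolution

/-! ### Averaging sections over orthogonal idempotents. -/

section Averaging

variable {A Q : Type*} [Ring A] [Fintype Q] {M N : Type*} [AddCommGroup M] [Module A M]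
  [AddCommGroup N] [Module A N]

/-- The average `m ↦ ∑ e, e • φ (e • m)` of an additive map over a family of elements. -/
noncomputable def averageMap (e : Q → A) (φ : M →+ N) : M →+ N :=
  AddMonoidHom.mk' (fun m => ∑ x, e x • φ (e x • m)) fun m m' => by
    simp [Finset.sum_add_distrib]

theorem averageMap_apply (e : Q → A) (φ : M →+ N) (m : M) :
    averageMap e φ m = ∑ x, e x • φ (e x • m) := rfl

variable {e : Q → A} {φ : M →+ N}

theorem mem_linearitySubring_averageMap (he : CompleteOrthogonalIdempotents e) (x : Q) :
    e x ∈ linearitySubring A (averageMap e φ) := fun m => by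
  rw [averageMap_apply, averageMap_apply, Finset.smul_sum, Finset.sum_eq_single x,
    Finset.sum_eq_single x]
  · simp only [smul_smul, (he.idem x).eq]
  · intro y _ hy
    rw [smul_smul, he.ortho hy.symm, zero_smul]
  · simp
  · intro y _ hy
    rw [smul_smul (e y) (e x), he.ortho hy, zero_smul, map_zero, smul_zero]
  · simp

theorem central_mem_linearitySubring_averageMap {r : A} (hr : ∀ a, r * a = a * r)
    (h : r ∈ linearitySubring A φ) : r ∈ linearitySubring A (averageMap e φ) := fun m => by
  simp only [averageMap_apply, Finset.smul_sum]
  refine Finset.sum_congr rfl fun x _ => ?_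
  rw [smul_smul, ← hr, mul_smul, h, smul_smul, smul_smul, hr]

/-- Averaging preserves linearity with respect to elements which permute the idempotents. -/
theorem mem_linearitySubring_averageMap_of_mem (he : CompleteOrthogonalIdempotents e) {b : A}
    (hl : ∀ x, ∃ y, b * e x = e y * b * e x) (hr : ∀ x, ∃ y, e x * b = e x * b * e y)
    (h : b ∈ linearitySubring A φ) : b ∈ linearitySubring A (averageMap e φ) := fun m => by
  -- If the block `e x * b * e y` is nonzero, the hypotheses force `e x * b` and `b * e y` both to
  -- equal it, so linearity of `φ` in `b` alone moves the block across.
  have key (x y : Q) : e x • φ ((e x * b * e y) • m) = (e x * b * e y) • φ (e y • m) := by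
    by_cases h0 : e x * b * e y = 0
    · rw [h0, zero_smul, zero_smul, map_zero, smul_zero]
    have h1 : e x * b = e x * b * e y := by
      obtain ⟨z, hz⟩ := hr x
      by_cases hzy : z = y
      · rwa [hzy] at hz
      · exact absurd (by rw [hz, mul_assoc, he.ortho hzy, mul_zero]) h0
    have h2 : b * e y = e x * b * e y := by
      obtain ⟨z, hz⟩ := hl y
      by_cases hzx : z = x
      · rwa [hzx] at hz
      · refine absurd ?_ h0
        rw [mul_assoc, hz, mul_assoc, ← mul_assoc, he.ortho (Ne.symm hzx), zero_mul]
    rw [← h2, mul_smul, h, smul_smul, h1, ← h2]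
  have hm (m : M) : ∑ y, e y • m = m := by rw [← Finset.sum_smul, he.complete, one_smul]
  have hn (m : N) : ∑ y, e y • m = m := by rw [← Finset.sum_smul, he.complete, one_smul]
  calc averageMap e φ (b • m) = ∑ x, ∑ y, e x • φ ((e x * b * e y) • m) := by
        rw [averageMap_apply]
        refine Finset.sum_congr rfl fun x _ => ?_
        rw [← Finset.smul_sum, ← map_sum]
        simp only [mul_smul]
        rw [← Finset.smul_sum, ← Finset.smul_sum, hm]
    _ = ∑ y, ∑ x, (e x * b * e y) • φ (e y • m) := by
        rw [Finset.sum_comm]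
        simp only [key]
    _ = b • averageMap e φ m := by
        rw [averageMap_apply, Finset.smul_sum]
        refine Finset.sum_congr rfl fun y _ => ?_
        simp only [mul_smul]
        rw [hn]

/-- A `B`-linear section of an `A`-linear map can be made linear with respect to the idempotents
which the generators of `B` permute. -/
theorem exists_section_linear_idempotents {k A Q M N : Type*} [Field k] [Ring A] [Algebra k A]
    [Fintype Q] [AddCommGroup M] [Module A M] [AddCommGroup N] [Module A N] {e : Q → A}
    (he : CompleteOrthogonalIdempotents e) {G : Set A} {B : Subalgebra k A}
    (hB : B = Algebra.adjoin k G) (hl : ∀ b ∈ G, ∀ x, ∃ y, b * e x = e y * b * e x)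
    (hr : ∀ b ∈ G, ∀ x, ∃ y, e x * b = e x * b * e y) (f : N →ₗ[A] M) (s : M →ₗ[B] N)
    (hs : ∀ x, f (s x) = x) :
    ∃ s' : M →+ N, (B : Set A) ∪ Set.range e ⊆ (linearitySubring A s' : Set A) ∧
      ∀ x, f (s' x) = x := by
  have hsB (b : A) (hb : b ∈ B) : b ∈ linearitySubring A s.toAddMonoidHom := fun m =>
    s.map_smul ⟨b, hb⟩ m
  refine ⟨averageMap e s.toAddMonoidHom, Set.union_subset (fun b hb => ?_) ?_, fun m => ?_⟩
  · rw [SetLike.mem_coe, hB] at hb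
    rw [SetLike.mem_coe]
    -- Sums in `B` need not permute the idempotents, so averaging is checked on generators only; the
    -- rest follows because the commuting scalars form a subring.
    induction hb using Algebra.adjoin_induction with
    | mem b hb =>
      exact mem_linearitySubring_averageMap_of_mem he (hl b hb) (hr b hb)
        (hsB b (hB ▸ Algebra.subset_adjoin hb))
    | algebraMap r =>
      exact central_mem_linearitySubring_averageMap (Algebra.commutes r)
        (hsB _ (B.algebraMap_mem r))
    | add x y _ _ hx hy => exact add_mem hx hy
    | mul x y _ _ hx hy => exact mul_mem hx hy
  · rintro _ ⟨x, rfl⟩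
    exact mem_linearitySubring_averageMap he x
  · rw [averageMap_apply, map_sum]
    calc ∑ x, f (e x • s (e x • m)) = ∑ x, e x • m := Finset.sum_congr rfl fun x _ => by
          rw [map_smul, hs, smul_smul, (he.idem x).eq]
      _ = m := by rw [← Finset.sum_smul, he.complete, one_smul]

end Averaging

/-! ### Levels of vertices and the support of the kernels. -/

namespace PathAlgebra

variable {k : Type u} [Field k] {Q : Type v} [Fintype Q] [Quiver.{w} Q]

theorem completeOrthogonalIdempotents_vertexBar (I : Ideal (PathAlgebra k Q)) [I.IsTwoSided] :
    CompleteOrthogonalIdempotents (vertexBar I) where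
  idem e := by
    rw [IsIdempotentElem, vertexBar, ← map_mul, vertex, ofPath_mul_ofPath, Quiver.Path.comp_nil]
  ortho x y h := by
    change vertexBar I x * vertexBar I y = 0
    rw [vertexBar, vertexBar, ← map_mul, vertex, vertex, ofPath_mul_ofPath_of_ne k _ _ h.symm,
      map_zero]
  complete := by
    simp only [vertexBar]
    rw [← map_sum, ← one_def, map_one]

/-- The image in `kQ/I` of a path. -/
noncomputable def pathBar (I : Ideal (PathAlgebra k Q)) [I.IsTwoSided] {a b : Q}
    (p : Quiver.Path a b) : PathAlgebra k Q ⧸ I :=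
  Ideal.Quotient.mk I (ofPath k p)

variable {I : Ideal (PathAlgebra k Q)} [I.IsTwoSided]

theorem pathBar_cons {a b c : Q} (p : Quiver.Path a b) (γ : b ⟶ c) :
    pathBar I (p.cons γ) = arrowBar I γ * pathBar I p := by
  rw [pathBar, pathBar, arrowBar, arrow, ← map_mul, ofPath_mul_ofPath]
  rfl

theorem vertexBar_mul_pathBar {a b : Q} (p : Quiver.Path a b) :
    vertexBar I b * pathBar I p = pathBar I p := by
  rw [pathBar, vertexBar, vertex, ← map_mul, ofPath_mul_ofPath, Quiver.Path.comp_nil]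

theorem pathBar_mul_vertexBar {a b : Q} (p : Quiver.Path a b) :
    pathBar I p * vertexBar I a = pathBar I p := by
  rw [pathBar, vertexBar, vertex, ← map_mul, ofPath_mul_ofPath, Quiver.Path.nil_comp]

theorem smul_pathBar_induction {P : PathAlgebra k Q ⧸ I → Prop} (x : PathAlgebra k Q ⧸ I)
    (h0 : P 0) (hp : ∀ (c : k) (a b : Q) (p : Quiver.Path a b), P (c • pathBar I p))
    (ha : ∀ x y, P x → P y → P (x + y)) : P x := by
  obtain ⟨y, rfl⟩ := Ideal.Quotient.mk_surjective x
  -- `P` is not assumed stable under scalars, so the scalar is carried through the induction.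
  suffices ∀ c : k, P (c • Ideal.Quotient.mk I y) by simpa using this 1
  refine induction (P := fun y => ∀ c : k, P (c • Ideal.Quotient.mk I y)) y ?_
    (fun a b p c => hp c a b p) (fun x y hx hy c => ?_) fun d x hx c => ?_
  · simpa using h0
  · rw [map_add, smul_add]
    exact ha _ _ (hx c) (hy c)
  · have : Ideal.Quotient.mk I (d • x) = d • Ideal.Quotient.mk I x := rfl
    rw [this, smul_smul]
    exact hx _

section Level

variable {lev : Q → ℕ}

theorem level_le_of_path {Q : Type*} [Quiver Q] {lev : Q → ℕ}
    (h₁ : ∀ {x y : Q}, (x ⟶ y) → lev y ≤ lev x) {a b : Q}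
    (p : Quiver.Path a b) : lev b ≤ lev a := by
  induction p with
  | nil => exact le_rfl
  | cons p γ ih => exact (h₁ γ).trans ih

/-- The level is weakly decreasing along a path, so equal levels at the ends make it constant and
every arrow of the path a loop. -/
theorem pathBar_mem_of_level_eq
    (h₁ : ∀ {x y : Q}, (x ⟶ y) → lev y ≤ lev x)
    (h₂ : ∀ {x y : Q}, (x ⟶ y) → lev x = lev y → x = y)
    {S : Subring (PathAlgebra k Q ⧸ I)}
    (hv : ∀ x, vertexBar I x ∈ S) (hl : ∀ (x : Q) (γ : x ⟶ x), arrowBar I γ ∈ S) {a b : Q}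
    (p : Quiver.Path a b) (h : lev b = lev a) : pathBar I p ∈ S := by
  induction p with
  | nil => exact hv a
  | cons p γ ih =>
    have hp := level_le_of_path h₁ p
    have hγ := h₁ γ
    obtain rfl := h₂ γ (by omega)
    rw [pathBar_cons]
    exact mul_mem (hl _ γ) (ih h)

/-- The module `M` is supported at the vertices of level less than `i`. -/
def SupportedBelow (I : Ideal (PathAlgebra k Q)) [I.IsTwoSided] (lev : Q → ℕ) (M : Type*)
    [AddCommGroup M] [Module (PathAlgebra k Q ⧸ I) M] (i : ℕ) : Prop :=
  ∀ x : Q, i ≤ lev x → ∀ m : M, vertexBar I x • m = 0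

theorem SupportedBelow.subsingleton {M : Type*} [AddCommGroup M]
    [Module (PathAlgebra k Q ⧸ I) M] (h : SupportedBelow I lev M 0) : Subsingleton M :=
  subsingleton_of_forall_eq 0 fun m => by
    rw [← one_smul (PathAlgebra k Q ⧸ I) m,
      ← (completeOrthogonalIdempotents_vertexBar I).complete, Finset.sum_smul]
    exact Finset.sum_eq_zero fun x _ => h x (Nat.zero_le _) m

open InducedModule

/-- Every element of the induced module at a vertex of top level comes from `M`. -/
theorem vertexBar_smul_mem_range_unit
    (h₁ : ∀ {x y : Q}, (x ⟶ y) → lev y ≤ lev x)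
    (h₂ : ∀ {x y : Q}, (x ⟶ y) → lev x = lev y → x = y)
    {T : Set (PathAlgebra k Q ⧸ I)} {M : Type*}
    [AddCommGroup M] [Module (PathAlgebra k Q ⧸ I) M]
    (hk : ∀ c : k, algebraMap k (PathAlgebra k Q ⧸ I) c ∈
      linearitySubring (PathAlgebra k Q ⧸ I) (unit T M))
    (hv : ∀ x, vertexBar I x ∈ linearitySubring (PathAlgebra k Q ⧸ I) (unit T M))
    (hl : ∀ (x : Q) (γ : x ⟶ x), arrowBar I γ ∈
      linearitySubring (PathAlgebra k Q ⧸ I) (unit T M)) {i : ℕ}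
    (hM : SupportedBelow I lev M (i + 1)) {x : Q} (hx : i ≤ lev x) (z : InducedModule T M) :
    vertexBar I x • z ∈ (unit T M).range := by
  refine InducedModule.induction (P := fun z => vertexBar I x • z ∈ (unit T M).range) z
    (by simp) (fun y z hy hz => ?_) fun a m => ?_
  · rw [smul_add]
    exact add_mem hy hz
  refine smul_pathBar_induction
    (P := fun a => vertexBar I x • a • unit T M m ∈ (unit T M).range) a (by simp)
    (fun c a b p => ?_) fun y z hy hz => ?_
  swap
  · rw [add_smul, smul_add]
    exact add_mem hy hz
  by_cases hxb : x = b
  · subst hxb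
    by_cases hxa : lev x = lev a
    · refine ⟨(vertexBar I x * c • pathBar I p) • m, ?_⟩
      rw [smul_smul]
      -- Membership in `linearitySubring` is itself the required equation at `m`.
      refine mul_mem (hv x) ?_ m
      rw [Algebra.smul_def]
      exact mul_mem (hk c) (pathBar_mem_of_level_eq h₁ h₂ hv hl p hxa)
    · have := level_le_of_path h₁ p
      -- The source `a` lies strictly above level `i`, so `M` vanishes there; the vertex `a` can be
      -- split off the path and moved across the tensor.
      have h0 : unit T M (vertexBar I a • m) = 0 := by rw [hM a (by omega), map_zero]
      rw [hv] at h0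
      rw [← pathBar_mul_vertexBar p, ← smul_mul_assoc, mul_smul, h0, smul_zero, smul_zero]
      exact zero_mem _
  · rw [← vertexBar_mul_pathBar p, smul_smul, mul_smul_comm, ← mul_assoc,
      (completeOrthogonalIdempotents_vertexBar I).ortho hxb, zero_mul, smul_zero, zero_smul]
    exact zero_mem _

/-- At a vertex `x` of level at least `i`, an element of the kernel becomes `1 ⊗ m`; applying the
counit gives `m = 0`. Each syzygy thus loses its top level. -/
theorem supportedBelow_ker_counit
    (h₁ : ∀ {x y : Q}, (x ⟶ y) → lev y ≤ lev x)
    (h₂ : ∀ {x y : Q}, (x ⟶ y) → lev x = lev y → x = y)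
    {T : Set (PathAlgebra k Q ⧸ I)} {M : Type*}
    [AddCommGroup M] [Module (PathAlgebra k Q ⧸ I) M]
    (hk : ∀ c : k, algebraMap k (PathAlgebra k Q ⧸ I) c ∈
      linearitySubring (PathAlgebra k Q ⧸ I) (unit T M))
    (hv : ∀ x, vertexBar I x ∈ linearitySubring (PathAlgebra k Q ⧸ I) (unit T M))
    (hl : ∀ (x : Q) (γ : x ⟶ x), arrowBar I γ ∈
      linearitySubring (PathAlgebra k Q ⧸ I) (unit T M)) {i : ℕ}
    (hM : SupportedBelow I lev M (i + 1)) :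
    SupportedBelow I lev (LinearMap.ker (counit T M)) i := by
  rintro x hx ⟨z, hz⟩
  obtain ⟨m, hm⟩ := vertexBar_smul_mem_range_unit h₁ h₂ hk hv hl hM hx z
  have h0 : m = 0 := by
    rw [← counit_unit (T := T) m, hm, map_smul, LinearMap.mem_ker.1 hz, smul_zero]
  ext1
  change vertexBar I x • z = 0
  rw [← hm, h0, map_zero]

end Level

end PathAlgebra

/-! ### Assembling the bound. -/

open PathAlgebra in
theorem mainTheorem4 {k : Type u} [Field k]
    {Q : Type v} [Fintype Q] [Quiver.{w} Q]
    (n : ℕ) (hn : 1 ≤ n) (V : Fin n → Set Q) (hV : ∀ x : Q, ∃! i, x ∈ V i)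
    (hV₁ : ∀ i j, i < j → ∀ x ∈ V i, ∀ y ∈ V j, IsEmpty (x ⟶ y))
    (hV₂ : ∀ i, ∀ x ∈ V i, ∀ y ∈ V i, x ≠ y → IsEmpty (x ⟶ y))
    (I : Ideal (PathAlgebra k Q)) [I.IsTwoSided] (hI : IsAdmissible I)
    {R : Type v'} [Quiver.{w'} R]
    (rv : R → PathAlgebra k Q ⧸ I)
    (hrv : ∀ x, ∃ S : Finset Q, rv x = ∑ e ∈ S, vertexBar I e)
    (ra : ∀ {x y : R}, (x ⟶ y) → PathAlgebra k Q ⧸ I)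
    (hra : ∀ {x y : R} (β : x ⟶ y) (e : Q), ∃ h g : Q,
      ra β * vertexBar I e = vertexBar I h * ra β * vertexBar I e ∧
      vertexBar I e * ra β = vertexBar I e * ra β * vertexBar I g)
    (B : Subalgebra k (PathAlgebra k Q ⧸ I))
    (hB : B = Algebra.adjoin k (Set.range rv ∪ {a | ∃ (x y : R) (β : x ⟶ y), a = ra β}))
    (hloop : ∀ (e : Q) (γ : e ⟶ e), ∃ β ∈ B, arrowBar I γ = vertexBar I e * β) :
    relGlobalDim.{u, max u v w, max u v w z} B ≤ ((n - 1 : ℕ) : ℕ∞) := by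
  have he := completeOrthogonalIdempotents_vertexBar I
  have hmul (S : Finset Q) (x : Q) :
      (∑ y ∈ S, vertexBar I y) * vertexBar I x = vertexBar I x * ∑ y ∈ S, vertexBar I y := by
    rw [Finset.sum_mul, Finset.mul_sum]
    refine Finset.sum_congr rfl fun y _ => ?_
    by_cases hxy : x = y
    · rw [hxy]
    · rw [he.ortho hxy, he.ortho (Ne.symm hxy)]
  have hl : ∀ b ∈ Set.range rv ∪ {a | ∃ (x y : R) (β : x ⟶ y), a = ra β}, ∀ x, ∃ y,
      b * vertexBar I x = vertexBar I y * b * vertexBar I x := by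
    rintro _ (⟨r, rfl⟩ | ⟨r, s, β, rfl⟩) x
    · obtain ⟨S, hS⟩ := hrv r
      exact ⟨x, by rw [hS, ← hmul, mul_assoc, (he.idem x).eq]⟩
    · obtain ⟨h, -, hh, -⟩ := hra β x
      exact ⟨h, hh⟩
  have hr : ∀ b ∈ Set.range rv ∪ {a | ∃ (x y : R) (β : x ⟶ y), a = ra β}, ∀ x, ∃ y,
      vertexBar I x * b = vertexBar I x * b * vertexBar I y := by
    rintro _ (⟨r, rfl⟩ | ⟨r, s, β, rfl⟩) x
    · obtain ⟨S, hS⟩ := hrv r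
      exact ⟨x, by rw [hS, mul_assoc, hmul, ← mul_assoc, (he.idem x).eq]⟩
    · obtain ⟨-, g, -, hg⟩ := hra β x
      exact ⟨g, hg⟩
  -- The level of a vertex is the index of its part.
  choose lev hlev using fun x => (hV x).exists
  have h₁ {x y : Q} (γ : x ⟶ y) : (lev y : ℕ) ≤ lev x := by
    by_contra! h
    exact (hV₁ _ _ h x (hlev x) y (hlev y)).false γ
  have h₂ {x y : Q} (γ : x ⟶ y) (h : (lev x : ℕ) = lev y) : x = y := by
    by_contra hxy
    exact (hV₂ _ x (hlev x) y (by rw [Fin.ext h]; exact hlev y) hxy).false γ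
  let T : Set (PathAlgebra k Q ⧸ I) := (B : Set _) ∪ Set.range (vertexBar I)
  refine iSup_le fun M => ?_
  -- All levels are below `n`, and each syzygy lowers the bound by one; the form `n ≤ i + j` avoids
  -- truncated subtraction.
  have hsupp (i j : ℕ) (hij : n ≤ i + j) :
      SupportedBelow I (fun x => (lev x : ℕ)) (inducedSyzygy.{max u v w, z} T M i) j := by
    induction i generalizing j with
    | zero => exact fun x hx => absurd (lev x).isLt (not_lt.2 (hij.trans (by simpa using hx)))
    | succ i ih =>
      have hT := InducedModule.subset_linearitySubring_unit T (inducedSyzygy.{max u v w, z} T M i)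
      have hv (x : Q) := hT (Or.inr ⟨x, rfl⟩)
      refine supportedBelow_ker_counit h₁ h₂ (fun c => hT (Or.inl (B.algebraMap_mem c))) hv
        (fun x γ => ?_) (ih (j + 1) (by omega))
      obtain ⟨β, hβ, h⟩ := hloop x γ
      rw [h]
      exact mul_mem (hv x) (hT (Or.inl hβ))
  -- For `i > n - 1` the bound may be taken to be `0`, so the `i`-th syzygy is zero.
  refine iInf₂_le (n - 1) ⟨inducedResolution.{u, max u v w, z} (T := T) Set.subset_union_left
    (fun M N _ _ _ _ f s hs => exists_section_linear_idempotents he hB hl hr f s hs) M (n - 1)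
    fun i hi => (hsupp i 0 (by omega)).subsingleton⟩
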